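/- An action of a group $\Gamma$ on an infinite countable set $X$ is called \emph{highly transitive} if, for every positive integer $k$, it is transitive on the set of ordered $k$-tuples of pairwise distinct elements of $X$; it is \emph{faithful} if the corresponding homomorphism $\Gamma\to\operatorname{Sym}(X)$ is injective. Let $G$ and $H$ be non-trivial groups, each of which is finite or infinite countable. Then the following statements are equivalent: (1) the free product $G*H$ admits a faithful and highly transitive action on an infinite countable set; (2) at least one of the groups $G$, $H$ is not isomorphic to the cyclic group $\mathbf{Z}/2\mathbf{Z}$. In particular, the group $\mathrm{PSL}_2(\mathbf{Z})\simeq(\mathbf{Z}/2\mathbf{Z})*(\mathbf{Z}/3\mathbf{Z})$ admits a faithful and highly transitive action on an infinite countable set. Moreover, the group $\mathrm{SL}_2(\mathbf{Z})$ admits a highly transitive action on an infinite countable set, but admits no action on an infinite countable set that is both faithful and highly transitive. -/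

import Mathlib

universe u v

/-- An action of `G` on `X` is highly transitive if, for every positive integer `k`, it is
transitive on ordered `k`-tuples of distinct points of `X` (that is, on `Fin k ↪ X`).
This is only used for infinite countable sets `X`. -/
def IsHighlyTransitive (G X : Type*) [Group G] [MulAction G X] : Prop :=
  ∀ k : ℕ, 0 < k → MulAction.IsMultiplyPretransitive G X k

/-- `G` admits a highly transitive action on some infinite countable set. -/
def AdmitsHighlyTransitiveAction (G : Type*) [Group G] : Prop :=
  ∃ (X : Type) (_ : Countable X) (_ : Infinite X) (_ : MulAction G X), IsHighlyTransitive G X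

/-- `G` admits a faithful and highly transitive action on some infinite countable set. -/
def AdmitsFaithfulHighlyTransitiveAction (G : Type*) [Group G] : Prop :=
  ∃ (X : Type) (_ : Countable X) (_ : Infinite X) (_ : MulAction G X),
    FaithfulSMul G X ∧ IsHighlyTransitive G X

/-- The cyclic group `ℤ/nℤ`, written multiplicatively. -/
abbrev CyclicGroup (n : ℕ) : Type := Multiplicative (ZMod n)

open Function Monoid

/-! Let `G` and `H` act by translations on `G × ℕ` and `H × ℕ`. A bijection `σ` between these sets
glues the two actions into an action of `G ∗ H` on `G × ℕ` (`twistedHom`). If `H` has at least three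
elements, a generic `σ`, built by a Baire category argument from finite partial bijections, gives a
faithful and highly transitive action. The partial bijections must be admissible: a finite set of
edges whose sources form a union of `G`-orbits and whose targets form a union of `H`-orbits would
create a finite invariant set.

High transitivity rests on `IsAdmissible.exists_escape`: after extending the partial bijection, one
word moves a given finite set out of its domain. Out there the values of `σ` are still free, so a
nontrivial `h` can be made to map one tuple to another, and conjugating by the word links the
original tuples (`IsAdmissible.exists_link`). Faithfulness comes from making each reduced word push
some point into fresh orbits (`IsReducedWord.exists_forces_ne`).

If both factors have order two, every element of the infinite dihedral group `G ∗ H` is a power of a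
fixed rotation or squares to one, which is incompatible with transitivity on triples. For the
modular group, ping-pong on integer vectors identifies `PSL₂(ℤ)` with the free product of cyclic
groups of orders 2 and 3. `SL₂(ℤ)` acts through this quotient, while its central element `-1`
excludes a faithful action. -/

/-- The free action of `G` on `G × ℕ` by left translations of the first coordinate. -/
def shiftHom (G : Type*) [Group G] : G →* Equiv.Perm (G × ℕ) where
  toFun g := (Equiv.mulLeft g).prodCongr (Equiv.refl ℕ)
  map_one' := by ext <;> simp
  map_mul' _ _ := by ext <;> simp [mul_assoc]

/-! ### Finite partial bijections from `G × ℕ` to `H × ℕ`. -/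

section PartialBijection

variable {G : Type u} {H : Type v}

/-- The bijection `σ` extends the partial bijection with graph `q`. -/
def Extends (q : Finset ((G × ℕ) × (H × ℕ))) (σ : G × ℕ ≃ H × ℕ) : Prop :=
  ∀ e ∈ q, σ e.1 = e.2

/-- The partial bijection with graph `q` is defined at `x`. -/
def Defined (q : Finset ((G × ℕ) × (H × ℕ))) (x : G × ℕ) : Prop :=
  ∃ y, (x, y) ∈ q

theorem Extends.mono {q q' : Finset ((G × ℕ) × (H × ℕ))} {σ : G × ℕ ≃ H × ℕ}
    (h : q ⊆ q') (hσ : Extends q' σ) : Extends q σ := fun e he => hσ e (h he)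

theorem Defined.mono {q q' : Finset ((G × ℕ) × (H × ℕ))} {x : G × ℕ}
    (h : q ⊆ q') (hx : Defined q x) : Defined q' x := hx.imp fun _ hy => h hy

theorem exists_fresh (q : Finset ((G × ℕ) × (H × ℕ))) :
    ∃ n : ℕ, ∀ e ∈ q, e.1.2 < n ∧ e.2.2 < n := by
  refine ⟨q.sup (fun e => e.1.2) + q.sup (fun e => e.2.2) + 1, fun e he => ?_⟩
  have h1 := Finset.le_sup (f := fun e : (G × ℕ) × (H × ℕ) => e.1.2) he
  have h2 := Finset.le_sup (f := fun e : (G × ℕ) × (H × ℕ) => e.2.2) he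
  omega

end PartialBijection

/-! ### Glued actions, admissible partial bijections and generic extensions. -/

section Twisted

variable {G : Type u} {H : Type v} [Group G] [Group H]

/-- The action of `G ∗ H` on `G × ℕ` where `G` acts by translations, and `H` acts by translations
of `H × ℕ` transported along `σ`. -/
def twistedHom (σ : G × ℕ ≃ H × ℕ) : Coprod G H →* Equiv.Perm (G × ℕ) :=
  Coprod.lift (shiftHom G) (σ.symm.permCongrHom.toMonoidHom.comp (shiftHom H))

@[simp]
theorem twistedHom_inl (σ : G × ℕ ≃ H × ℕ) (g : G) (x : G × ℕ) :
    twistedHom σ (Coprod.inl g) x = (g * x.1, x.2) := rfl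

@[simp]
theorem twistedHom_inr (σ : G × ℕ ≃ H × ℕ) (h : H) (x : G × ℕ) :
    twistedHom σ (Coprod.inr h) x = σ.symm (h * (σ x).1, (σ x).2) := rfl

/-- A finite set of edges is admissible if it is the graph of a partial bijection without
nonempty closed part. -/
structure IsAdmissible (q : Finset ((G × ℕ) × (H × ℕ))) : Prop where
  right_unique : ∀ a ∈ q, ∀ b ∈ q, a.1 = b.1 → a.2 = b.2
  left_unique : ∀ a ∈ q, ∀ b ∈ q, a.2 = b.2 → a.1 = b.1
  not_closed : ∀ O ⊆ q, O.Nonempty →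
    (∀ e ∈ O, ∀ g : G, ∃ e' ∈ O, e'.1 = (g * e.1.1, e.1.2)) →
    ¬ ∀ e ∈ O, ∀ h : H, ∃ e' ∈ O, e'.2 = (h * e.2.1, e.2.2)

/-- The element `w` maps `f` to `x` for every bijection extending `q`. -/
def Forces (q : Finset ((G × ℕ) × (H × ℕ))) (w : Coprod G H) (f x : G × ℕ) : Prop :=
  ∀ σ, Extends q σ → twistedHom σ w f = x

theorem Forces.mono {q q' : Finset ((G × ℕ) × (H × ℕ))} {w : Coprod G H} {f x : G × ℕ}
    (h : q ⊆ q') (hw : Forces q w f x) : Forces q' w f x := fun σ hσ => hw σ (hσ.mono h)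

theorem Forces.inl_mul {q : Finset ((G × ℕ) × (H × ℕ))} {w : Coprod G H} {f x : G × ℕ}
    (hw : Forces q w f x) (g : G) : Forces q (Coprod.inl g * w) f (g * x.1, x.2) := by
  intro σ hσ
  rw [map_mul, Equiv.Perm.mul_apply, hw σ hσ, twistedHom_inl]

theorem Forces.inr_mul {q : Finset ((G × ℕ) × (H × ℕ))} {w : Coprod G H} {f x x' : G × ℕ}
    {y : H × ℕ} {h : H} (hw : Forces q w f x) (hy : (x, y) ∈ q)
    (hx' : (x', (h * y.1, y.2)) ∈ q) : Forces q (Coprod.inr h * w) f x' := by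
  intro σ hσ
  have h1 : σ x = y := hσ _ hy
  have h2 : σ x' = (h * y.1, y.2) := hσ _ hx'
  rw [map_mul, Equiv.Perm.mul_apply, hw σ hσ, twistedHom_inr, h1, ← h2, Equiv.symm_apply_apply]

theorem isAdmissible_empty : IsAdmissible (∅ : Finset ((G × ℕ) × (H × ℕ))) where
  right_unique := by simp
  left_unique := by simp
  not_closed O hO hne := by
    rw [Finset.subset_empty.1 hO] at hne
    exact absurd hne Finset.not_nonempty_empty

-- Admissibility is symmetric in `G` and `H`, so an extension result for the domain also gives one
-- for the range.
open Classical in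
theorem IsAdmissible.swap {q : Finset ((G × ℕ) × (H × ℕ))} (hq : IsAdmissible q) :
    IsAdmissible (q.image Prod.swap) where
  right_unique := by
    simp only [Finset.mem_image]
    rintro _ ⟨a, ha, rfl⟩ _ ⟨b, hb, rfl⟩ h
    exact hq.left_unique a ha b hb h
  left_unique := by
    simp only [Finset.mem_image]
    rintro _ ⟨a, ha, rfl⟩ _ ⟨b, hb, rfl⟩ h
    exact hq.right_unique a ha b hb h
  not_closed O hO hne h1 h2 := by
    refine hq.not_closed (O.image Prod.swap) ?_ (hne.image _) ?_ ?_
    · intro e he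
      obtain ⟨e', he', rfl⟩ := Finset.mem_image.1 he
      obtain ⟨e, heq, rfl⟩ := Finset.mem_image.1 (hO he')
      exact heq
    · simp only [Finset.mem_image]
      rintro _ ⟨a, ha, rfl⟩ g
      obtain ⟨e', he', h⟩ := h2 a ha g
      exact ⟨_, ⟨e', he', rfl⟩, h⟩
    · simp only [Finset.mem_image]
      rintro _ ⟨a, ha, rfl⟩ g
      obtain ⟨e', he', h⟩ := h1 a ha g
      exact ⟨_, ⟨e', he', rfl⟩, h⟩

open Classical in
/-- Edges which end in new `H`-orbits, none of which they exhaust, may be added. -/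
theorem IsAdmissible.union {q N : Finset ((G × ℕ) × (H × ℕ))} (hq : IsAdmissible q)
    (hN : ∀ a ∈ N, ∀ b ∈ N, a.1 = b.1 ↔ a.2 = b.2)
    (hX : ∀ e ∈ N, ∀ e' ∈ q, e.1 ≠ e'.1) (hY : ∀ e ∈ N, ∀ e' ∈ q, e.2.2 ≠ e'.2.2)
    (hfree : ∀ e ∈ N, ∃ h : H, ∀ e' ∈ N, e'.2 ≠ (h, e.2.2)) : IsAdmissible (q ∪ N) where
  right_unique a ha b hb hab := by
    rcases Finset.mem_union.1 ha with ha | ha <;> rcases Finset.mem_union.1 hb with hb | hb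
    · exact hq.right_unique a ha b hb hab
    · exact absurd hab.symm (hX b hb a ha)
    · exact absurd hab (hX a ha b hb)
    · exact (hN a ha b hb).1 hab
  left_unique a ha b hb hab := by
    rcases Finset.mem_union.1 ha with ha | ha <;> rcases Finset.mem_union.1 hb with hb | hb
    · exact hq.left_unique a ha b hb hab
    · exact absurd (congrArg Prod.snd hab.symm) (hY b hb a ha)
    · exact absurd (congrArg Prod.snd hab) (hY a ha b hb)
    · exact (hN a ha b hb).2 hab
  not_closed O hO hne h1 h2 := by
    refine hq.not_closed O (fun e he => ?_) hne h1 h2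
    refine (Finset.mem_union.1 (hO he)).resolve_right fun heN => ?_
    -- A closed part containing a new edge would contain edges onto its whole `H`-orbit, yet `h`
    -- marks a point of that orbit which is not hit.
    obtain ⟨h, hh⟩ := hfree e heN
    obtain ⟨e', he', hee⟩ := h2 e he (h * e.2.1⁻¹)
    rw [inv_mul_cancel_right] at hee
    rcases Finset.mem_union.1 (hO he') with h3 | h3
    · exact hY e heN e' h3 (by rw [hee])
    · exact hh e' h3 hee

open Classical in
/-- A partial bijection may be extended to a finite set by sending new points to new orbits. -/
theorem IsAdmissible.exists_cross [Countable G] [Nontrivial H]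
    {q : Finset ((G × ℕ) × (H × ℕ))} (hq : IsAdmissible q) (U : Finset (G × ℕ)) :
    ∃ N : Finset ((G × ℕ) × (H × ℕ)), IsAdmissible (q ∪ N) ∧ (∀ x ∈ U, Defined (q ∪ N) x) ∧
      ∀ e ∈ N, e.1 ∈ U ∧ ¬ Defined q e.1 ∧ e.2.1 = 1 ∧ ∀ e' ∈ q, e.2.2 ≠ e'.2.2 := by
  obtain ⟨n, hn⟩ := exists_fresh q
  obtain ⟨c, hc⟩ := exists_injective_nat (G × ℕ)
  -- Injectivity of `c` gives each new point its own orbit, and the shift by `n` makes the orbit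
  -- fresh. Only the point over `1` is used, so a nontrivial `H` leaves part of the orbit free.
  let N : Finset ((G × ℕ) × (H × ℕ)) :=
    (U.filter fun x => ¬ Defined q x).image fun x => (x, (1, n + c x))
  have key : ∀ e ∈ N, e.1 ∈ U ∧ ¬ Defined q e.1 ∧ e.2 = (1, n + c e.1) := by
    intro e he
    obtain ⟨x, hx, rfl⟩ := Finset.mem_image.1 he
    exact ⟨(Finset.mem_filter.1 hx).1, (Finset.mem_filter.1 hx).2, rfl⟩
  have hY : ∀ e ∈ N, ∀ e' ∈ q, e.2.2 ≠ e'.2.2 := by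
    intro e he e' he'
    have h1 := (key e he).2.2
    have h2 := (hn e' he').2
    rw [h1]
    dsimp only
    omega
  refine ⟨N, hq.union ?_ ?_ hY ?_, ?_, ?_⟩
  · intro a ha b hb
    rw [(key a ha).2.2, (key b hb).2.2]
    simp [hc.eq_iff]
  · intro e he e' he' h
    exact (key e he).2.1 ⟨e'.2, by rw [h]; exact he'⟩
  · intro e he
    obtain ⟨h, hh⟩ := exists_ne (1 : H)
    refine ⟨h, fun e' he' h' => hh ?_⟩
    rw [(key e' he').2.2] at h'
    exact (congrArg Prod.fst h').symm
  · intro x hx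
    by_cases hd : Defined q x
    · exact hd.mono Finset.subset_union_left
    · exact ⟨_, Finset.mem_union_right _
        (Finset.mem_image.2 ⟨x, Finset.mem_filter.2 ⟨hx, hd⟩, rfl⟩)⟩
  · intro e he
    exact ⟨(key e he).1, (key e he).2.1, by rw [(key e he).2.2], hY e he⟩

open Classical in
/-- The version of `IsAdmissible.exists_cross` for the inverse partial bijection. -/
theorem IsAdmissible.exists_cross_back [Countable H] [Nontrivial G]
    {q : Finset ((G × ℕ) × (H × ℕ))} (hq : IsAdmissible q) (V : Finset (H × ℕ)) :
    ∃ N : Finset ((G × ℕ) × (H × ℕ)), IsAdmissible (q ∪ N) ∧ (∀ y ∈ V, ∃ x, (x, y) ∈ q ∪ N) ∧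
      ∀ e ∈ N, e.2 ∈ V ∧ (∀ e' ∈ q, e'.2 ≠ e.2) ∧ e.1.1 = 1 ∧ ∀ e' ∈ q, e.1.2 ≠ e'.1.2 := by
  obtain ⟨N, h1, h2, h3⟩ := hq.swap.exists_cross V
  refine ⟨N.image Prod.swap, ?_, ?_, ?_⟩
  · have := h1.swap
    rwa [Finset.image_union, Finset.image_image, Prod.swap_swap_eq, Finset.image_id] at this
  · intro y hy
    obtain ⟨x, hx⟩ := h2 y hy
    refine ⟨x, ?_⟩
    rcases Finset.mem_union.1 hx with hx | hx
    · obtain ⟨e, he, hee⟩ := Finset.mem_image.1 hx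
      rw [← Prod.swap_swap e, hee] at he
      exact Finset.mem_union_left _ he
    · exact Finset.mem_union_right _ (Finset.mem_image.2 ⟨_, hx, rfl⟩)
  · intro e he
    obtain ⟨e, heN, rfl⟩ := Finset.mem_image.1 he
    obtain ⟨a, b, c, d⟩ := h3 e heN
    refine ⟨a, fun e' he' h => b ⟨e'.1, ?_⟩, c, fun e' he' => ?_⟩
    · have h : e'.2 = e.1 := h
      rw [← h]
      exact Finset.mem_image.2 ⟨e', he', rfl⟩
    · exact d e'.swap (Finset.mem_image.2 ⟨e', he', rfl⟩)

/-- Bijections which are generic for a countable family of dense sets of admissible partial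
bijections. -/
theorem IsAdmissible.exists_generic [Countable G] [Countable H] [Nontrivial G] [Nontrivial H]
    {ι : Type*} [Countable ι] (D : ι → Finset ((G × ℕ) × (H × ℕ)) → Prop)
    (hD : ∀ i q, IsAdmissible q → ∃ q', q ⊆ q' ∧ IsAdmissible q' ∧ D i q')
    {q : Finset ((G × ℕ) × (H × ℕ))} (hq : IsAdmissible q) :
    ∃ σ : G × ℕ ≃ H × ℕ, Extends q σ ∧ ∀ i, ∃ q', D i q' ∧ Extends q' σ := by
  classical
  let P := {q : Finset ((G × ℕ) × (H × ℕ)) // IsAdmissible q}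
  let 𝒟 : (G × ℕ) ⊕ (H × ℕ) ⊕ ι → Order.Cofinal P := fun j => match j with
    | .inl x => ⟨{p | Defined p.1 x}, fun p => by
        obtain ⟨N, h1, h2, -⟩ := p.2.exists_cross {x}
        exact ⟨⟨_, h1⟩, h2 x (by simp), Finset.subset_union_left (s₁ := p.1)⟩⟩
    | .inr (.inl y) => ⟨{p | ∃ x, (x, y) ∈ p.1}, fun p => by
        obtain ⟨N, h1, h2, -⟩ := p.2.exists_cross_back {y}
        exact ⟨⟨_, h1⟩, h2 y (by simp), Finset.subset_union_left (s₁ := p.1)⟩⟩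
    | .inr (.inr i) => ⟨{p | D i p.1}, fun p => by
        obtain ⟨q', h1, h2, h3⟩ := hD i p.1 p.2
        exact ⟨⟨q', h2⟩, h3, h1⟩⟩
  let _ : Encodable ((G × ℕ) ⊕ (H × ℕ) ⊕ ι) := Encodable.ofCountable _
  -- Rasiowa–Sikorski: the ideal meets every prescribed dense set, and its directedness makes the
  -- union of the graphs a bijection.
  let I := Order.idealOfCofinals (⟨q, hq⟩ : P) 𝒟
  have hI : ∀ p₁ ∈ I, ∀ p₂ ∈ I, ∃ p ∈ I, p₁.1 ⊆ p.1 ∧ p₂.1 ⊆ p.1 := fun p₁ h₁ p₂ h₂ =>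
    I.directed p₁ h₁ p₂ h₂
  have hx : ∀ x, ∃ y, ∃ p ∈ I, (x, y) ∈ p.1 := fun x => by
    obtain ⟨p, ⟨y, hy⟩, hp⟩ := Order.cofinal_meets_idealOfCofinals (⟨q, hq⟩ : P) 𝒟 (.inl x)
    exact ⟨y, p, hp, hy⟩
  have hy : ∀ y, ∃ x, ∃ p ∈ I, (x, y) ∈ p.1 := fun y => by
    obtain ⟨p, ⟨x, hx⟩, hp⟩ := Order.cofinal_meets_idealOfCofinals (⟨q, hq⟩ : P) 𝒟 (.inr (.inl y))
    exact ⟨x, p, hp, hx⟩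
  choose s hs using hx
  choose t ht using hy
  have hst : ∀ p ∈ I, ∀ e ∈ p.1, s e.1 = e.2 ∧ t e.2 = e.1 := by
    intro p hp e he
    obtain ⟨p₁, hp₁, h₁⟩ := hs e.1
    obtain ⟨p₂, hp₂, h₂⟩ := ht e.2
    obtain ⟨p₃, -, h₃, h₃'⟩ := hI p hp p₁ hp₁
    obtain ⟨p₄, -, h₄, h₄'⟩ := hI p hp p₂ hp₂
    exact ⟨p₃.2.right_unique _ (h₃' h₁) _ (h₃ he) rfl, p₄.2.left_unique _ (h₄' h₂) _ (h₄ he) rfl⟩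
  refine ⟨⟨s, t, fun x => ?_, fun y => ?_⟩, ?_, ?_⟩
  · obtain ⟨p, hp, h⟩ := hs x
    exact (hst p hp _ h).2
  · obtain ⟨p, hp, h⟩ := ht y
    exact (hst p hp _ h).1
  · exact fun e he => (hst _ (Order.mem_idealOfCofinals (⟨q, hq⟩ : P) 𝒟) e he).1
  · intro i
    obtain ⟨p, hp, hpI⟩ :=
      Order.cofinal_meets_idealOfCofinals (⟨q, hq⟩ : P) 𝒟 (.inr (.inr i))
    exact ⟨p.1, hp, fun e he => (hst p hpI e he).1⟩

/-- This keeps `Forces` from being vacuous: for an admissible `q`, forced images really are images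
under a permutation. -/
theorem IsAdmissible.exists_extends [Countable G] [Countable H] [Nontrivial G] [Nontrivial H]
    {q : Finset ((G × ℕ) × (H × ℕ))} (hq : IsAdmissible q) :
    ∃ σ : G × ℕ ≃ H × ℕ, Extends q σ := by
  obtain ⟨σ, h, -⟩ := hq.exists_generic (ι := PEmpty.{1}) (fun i _ => i.elim) (fun i => i.elim)
  exact ⟨σ, h⟩

end Twisted

/-! ### Applying one letter of `H` to finitely many points. -/

section Escape

variable {G : Type u} {H : Type v} [Group G] [Group H]

/-- A finite set which is mapped into itself by all products of a nontrivial element of `G` and a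
nontrivial element of `H` is invariant. -/
theorem invariant_of_mapsTo_mul [Nontrivial G] [Nontrivial H] {X : Type*} (hH : ∀ a b : H, ∃ k, k ≠ a ∧ k ≠ b)
    (a : G →* Equiv.Perm X) (b : H →* Equiv.Perm X) {O : Set X} (hfin : O.Finite)
    (hO : ∀ g : G, g ≠ 1 → ∀ h : H, h ≠ 1 → ∀ x ∈ O, a g (b h x) ∈ O) :
    (∀ g, ∀ x ∈ O, a g x ∈ O) ∧ ∀ h, ∀ x ∈ O, b h x ∈ O := by
  have hiff : ∀ g : G, g ≠ 1 → ∀ h : H, h ≠ 1 → ∀ x, a g (b h x) ∈ O ↔ x ∈ O := by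
    intro g hg h hh x
    refine ⟨fun hx => ?_, hO g hg h hh x⟩
    -- An injective self-map of a finite set is onto, so the permutation also reflects membership in
    -- `O`.
    have hmaps : Set.MapsTo (a g * b h) O O := fun y hy => hO g hg h hh y hy
    have hsurj := ((hfin.injOn_iff_bijOn_of_mapsTo hmaps).1 (a g * b h).injective.injOn).surjOn
    obtain ⟨y, hy, hxy⟩ := hsurj hx
    rwa [← (a g * b h).injective hxy]
  obtain ⟨g₀, hg₀⟩ := exists_ne (1 : G)
  have hb : ∀ h, ∀ x ∈ O, b h x ∈ O := by
    intro h x hx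
    -- A third element writes `h` as a quotient of two nontrivial elements: both `g₀k⁻¹` applied to
    -- `x` and `g₀(k⁻¹h⁻¹)` applied to `hx` give the same point.
    obtain ⟨k, hk1, hk2⟩ := hH 1 h⁻¹
    rw [← hiff g₀ hg₀ k⁻¹ (inv_ne_one.2 hk1)] at hx
    rw [← hiff g₀ hg₀ (k⁻¹ * h⁻¹) fun h1 => hk2 (inv_mul_eq_one.1 h1),
      ← Equiv.Perm.mul_apply (b _), ← map_mul, inv_mul_cancel_right]
    exact hx
  refine ⟨fun g x hx => ?_, hb⟩
  by_cases hg : g = 1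
  · simpa [hg] using hx
  · obtain ⟨k, hk⟩ := exists_ne (1 : H)
    have := hO g hg k hk _ (hb k⁻¹ x hx)
    rwa [← Equiv.Perm.mul_apply (b k), ← map_mul, mul_inv_cancel, map_one] at this

variable [Countable G] [Countable H]
  [Nontrivial G] [Nontrivial H]

open Classical in
/-- Any nontrivial element of `H` may be applied to a finite set of points in such a way that the
points where `q` is undefined go to new orbits. -/
theorem IsAdmissible.exists_step (hH : ∀ a b : H, ∃ k, k ≠ a ∧ k ≠ b)
    {q : Finset ((G × ℕ) × (H × ℕ))} (hq : IsAdmissible q) {F : Finset (G × ℕ)} {w : Coprod G H}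
    {pos : G × ℕ → G × ℕ} (hw : ∀ f ∈ F, Forces q w f (pos f)) {h : H} (hh : h ≠ 1) :
    ∃ q' : Finset ((G × ℕ) × (H × ℕ)), ∃ pos' : G × ℕ → G × ℕ, q ⊆ q' ∧ IsAdmissible q' ∧ (∀ f ∈ F, Forces q' (Coprod.inr h * w) f (pos' f)) ∧
      (∀ f ∈ F, ¬ Defined q (pos f) → (∀ e ∈ q, e.1.2 ≠ (pos' f).2) ∧
        ∀ g : G, g ≠ 1 → ¬ Defined q' (g * (pos' f).1, (pos' f).2)) ∧
      (∀ f ∈ F, ∀ y, (pos f, y) ∈ q → (∀ x', (x', (h * y.1, y.2)) ∉ q) →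
        ∀ g : G, g ≠ 1 → ¬ Defined q' (g * (pos' f).1, (pos' f).2)) ∧
      (∀ f ∈ F, ∀ y x', (pos f, y) ∈ q → (x', (h * y.1, y.2)) ∈ q → pos' f = x') ∧
      ((∀ f ∈ F, ∀ y, (pos f, y) ∈ q → ∃ x', (x', (h * y.1, y.2)) ∈ q) →
        ∀ e ∈ q', e ∉ q → (∀ e₀ ∈ q, e.2.2 ≠ e₀.2.2) ∧ ∃ k : H, ∀ e' ∈ q', e'.2 ≠ (k, e.2.2)) := by
  -- `N₁` defines the bijection at the current positions; `N₂` below defines its inverse at their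
  -- translates by `h`. Endpoints of `N₂` lie over `1` in fresh `G`-orbits, so any further
  -- nontrivial `g` leads out of the domain.
  obtain ⟨N₁, hq₁, hd₁, hN₁⟩ := hq.exists_cross (F.image pos)
  have hη : ∀ f, ∃ y, f ∈ F → (pos f, y) ∈ q ∪ N₁ := fun f => by
    by_cases hf : f ∈ F
    · obtain ⟨y, hy⟩ := hd₁ (pos f) (Finset.mem_image_of_mem _ hf)
      exact ⟨y, fun _ => hy⟩
    · exact ⟨(1, 0), fun h => absurd h hf⟩
  choose η hη using hη
  obtain ⟨N₂, hq₂, hd₂, hN₂⟩ :=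
    hq₁.exists_cross_back (F.image fun f => (h * (η f).1, (η f).2))
  have hξ : ∀ f, ∃ x, f ∈ F → (x, (h * (η f).1, (η f).2)) ∈ q ∪ N₁ ∪ N₂ := fun f => by
    by_cases hf : f ∈ F
    · obtain ⟨y, hy⟩ := hd₂ _ (Finset.mem_image_of_mem _ hf)
      exact ⟨y, fun _ => hy⟩
    · exact ⟨(1, 0), fun h => absurd h hf⟩
  choose ξ hξ using hξ
  have hsub₁ : q ⊆ q ∪ N₁ := Finset.subset_union_left
  have hsub₂ : q ∪ N₁ ⊆ q ∪ N₁ ∪ N₂ := Finset.subset_union_left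
  have hnew : ∀ x y, (x, y) ∈ N₂ → ∀ g : G, g ≠ 1 →
      ¬ Defined (q ∪ N₁ ∪ N₂) (g * x.1, x.2) := by
    rintro x y hxy g hg ⟨y', hy'⟩
    obtain ⟨-, -, h1, h2⟩ := hN₂ _ hxy
    rcases Finset.mem_union.1 hy' with h3 | h3
    · exact h2 _ h3 rfl
    · have h4 := (hN₂ _ h3).2.2.1
      dsimp only at h1 h4
      rw [h1, mul_one] at h4
      exact hg h4
  have hηN : ∀ f ∈ F, (pos f, η f) ∈ N₁ → (ξ f, (h * (η f).1, (η f).2)) ∈ N₂ := by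
    intro f hf h1
    obtain ⟨-, -, h2, h3⟩ := hN₁ _ h1
    refine (Finset.mem_union.1 (hξ f hf)).resolve_left fun h4 => ?_
    rcases Finset.mem_union.1 h4 with h5 | h5
    · exact h3 _ h5 rfl
    · have h6 := (hN₁ _ h5).2.2.1
      dsimp only at h2 h6
      rw [h2, mul_one] at h6
      exact hh h6
  have hηq : ∀ f ∈ F, ∀ y, (pos f, y) ∈ q → η f = y := fun f hf y hy =>
    hq₁.right_unique _ (hη f hf) _ (hsub₁ hy) rfl
  have hfree : ∀ e ∈ N₁, ∃ k : H, ∀ e' ∈ q ∪ N₁ ∪ N₂, e'.2 ≠ (k, e.2.2) := by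
    intro e he
    -- In the fresh `H`-orbits of `N₁` only the points over `1` and `h` can be hit, so a third
    -- element stays free.
    obtain ⟨k, hk1, hkh⟩ := hH 1 h
    refine ⟨k, fun e' he' hee => ?_⟩
    rcases Finset.mem_union.1 he' with he' | he'
    · rcases Finset.mem_union.1 he' with he' | he'
      · exact (hN₁ e he).2.2.2 e' he' (by rw [hee])
      · have := (hN₁ e' he').2.2.1
        rw [hee] at this
        exact hk1 this
    · obtain ⟨f, hf, hfe⟩ := Finset.mem_image.1 (hN₂ e' he').1
      rw [hee, Prod.mk.injEq] at hfe
      rcases Finset.mem_union.1 (hη f hf) with h1 | h1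
      · exact (hN₁ e he).2.2.2 _ h1 hfe.2.symm
      · have := (hN₁ _ h1).2.2.1
        dsimp only at this
        rw [this, mul_one] at hfe
        exact hkh hfe.1.symm
  refine ⟨q ∪ N₁ ∪ N₂, ξ, hsub₁.trans hsub₂, hq₂, ?_, ?_, ?_, ?_, ?_⟩
  · intro f hf
    exact ((hw f hf).mono (hsub₁.trans hsub₂)).inr_mul (hsub₂ (hη f hf)) (hξ f hf)
  · intro f hf hd
    have h1 : (pos f, η f) ∈ N₁ :=
      (Finset.mem_union.1 (hη f hf)).resolve_left fun h => hd ⟨_, h⟩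
    have h2 := hηN f hf h1
    exact ⟨fun e he h3 => (hN₂ _ h2).2.2.2 e (hsub₁ he) h3.symm, hnew _ _ h2⟩
  · intro f hf y hy hno
    refine hnew _ _ ((Finset.mem_union.1 (hξ f hf)).resolve_left fun h1 => ?_)
    rw [hηq f hf y hy] at h1
    rcases Finset.mem_union.1 h1 with h2 | h2
    · exact hno _ h2
    · exact (hN₁ _ h2).2.2.2 _ hy rfl
  · intro f hf y x' hy hx'
    refine hq₂.left_unique _ (hξ f hf) _ (hsub₂ (hsub₁ hx')) ?_
    rw [hηq f hf y hy]
  · intro hall e he heq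
    rcases Finset.mem_union.1 he with he | he
    · have he := (Finset.mem_union.1 he).resolve_left heq
      exact ⟨(hN₁ e he).2.2.2, hfree e he⟩
    · obtain ⟨f, hf, hfe⟩ := Finset.mem_image.1 (hN₂ e he).1
      have h1 : (pos f, η f) ∈ N₁ := by
        refine (Finset.mem_union.1 (hη f hf)).resolve_left fun h1 => ?_
        obtain ⟨x', hx'⟩ := hall f hf _ h1
        exact (hN₂ e he).2.1 _ (hsub₁ hx') hfe
      have h2 := hfree _ h1
      have h3 := (hN₁ _ h1).2.2.2
      rw [← hfe]
      exact ⟨h3, h2⟩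

end Escape

/-! ### Escaping from the domain, and linking tuples. -/

section Link

variable {G : Type u} {H : Type v} [Group G] [Group H] [Countable G] [Countable H]
  [Nontrivial G] [Nontrivial H]

open Classical in
/-- A point which has not left the domain of `q` can be made to leave an extension, while the points
outside of the domain stay outside. -/
theorem IsAdmissible.exists_escape_more (hH : ∀ a b : H, ∃ k, k ≠ a ∧ k ≠ b)
    {q : Finset ((G × ℕ) × (H × ℕ))} (hq : IsAdmissible q) {F : Finset (G × ℕ)} {w : Coprod G H}
    {pos : G × ℕ → G × ℕ} (hw : ∀ f ∈ F, Forces q w f (pos f)) {f₀ : G × ℕ} (hf₀ : f₀ ∈ F)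
    (hd₀ : Defined q (pos f₀)) :
    ∃ q' : Finset ((G × ℕ) × (H × ℕ)), ∃ w' : Coprod G H, ∃ pos' : G × ℕ → G × ℕ,
      q ⊆ q' ∧ IsAdmissible q' ∧ (∀ f ∈ F, Forces q' w' f (pos' f)) ∧
      (∀ f ∈ F, ¬ Defined q (pos f) → ¬ Defined q' (pos' f)) ∧
      ∃ f ∈ F, Defined q (pos f) ∧ ¬ Defined q' (pos' f) := by
  by_contra hcon
  have hmax : ∀ (q' : Finset ((G × ℕ) × (H × ℕ))) (w' : Coprod G H) (pos' : G × ℕ → G × ℕ),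
      q ⊆ q' → IsAdmissible q' → (∀ f ∈ F, Forces q' w' f (pos' f)) →
      (∀ f ∈ F, ¬ Defined q (pos f) → ¬ Defined q' (pos' f)) →
      ∀ f ∈ F, Defined q (pos f) → Defined q' (pos' f) := by
    intro q' w' pos' h1 h2 h3 h4 f hf hd
    by_contra hd'
    exact hcon ⟨q', w', pos', h1, h2, h3, h4, f, hf, hd, hd'⟩
  -- Assuming no further escape is possible, these are the configurations in which trapped points
  -- still lie in the domain of the original `q`, and the added edges only partly fill `H`-orbits
  -- disjoint from those of `q`.
  let Reach : Finset ((G × ℕ) × (H × ℕ)) → Coprod G H → (G × ℕ → G × ℕ) → Prop :=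
    fun q' w' pos' => q ⊆ q' ∧ IsAdmissible q' ∧ (∀ f ∈ F, Forces q' w' f (pos' f)) ∧
      (∀ f ∈ F, ¬ Defined q (pos f) → ¬ Defined q' (pos' f)) ∧
      (∀ f ∈ F, Defined q (pos f) → Defined q (pos' f)) ∧
      ∀ e ∈ q', e ∉ q → (∀ e₀ ∈ q, e.2.2 ≠ e₀.2.2) ∧ ∃ k : H, ∀ e' ∈ q', e'.2 ≠ (k, e.2.2)
  have hstep : ∀ q' w' pos', Reach q' w' pos' → ∀ g : G, g ≠ 1 → ∀ h : H, h ≠ 1 →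
      ∃ q'' w'' pos'', Reach q'' w'' pos'' ∧ ∀ f ∈ F, Defined q (pos f) → ∀ y, (pos' f, y) ∈ q →
        ∃ x', (x', (h * y.1, y.2)) ∈ q ∧ pos'' f = (g * x'.1, x'.2) := by
    rintro q' w' pos' ⟨hqq', hq', hw', hout, hin, hhair⟩ g hg h hh
    obtain ⟨q'', ξ, hsub, hq'', hξ, hb, hc, hd, he⟩ := hq'.exists_step hH hw' hh
    have hw'' : ∀ f ∈ F, Forces q'' (Coprod.inl g * (Coprod.inr h * w')) f
        (g * (ξ f).1, (ξ f).2) := fun f hf => (hξ f hf).inl_mul g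
    have hout'' : ∀ f ∈ F, ¬ Defined q (pos f) → ¬ Defined q'' (g * (ξ f).1, (ξ f).2) :=
      fun f hf hdf => (hb f hf (hout f hf hdf)).2 g hg
    have hd'' := hmax q'' _ _ (hqq'.trans hsub) hq'' hw'' hout''
    -- If the translate by `h` were not yet hit, it would land in a fresh `G`-orbit and `g` would
    -- free the point. If it is hit, the edge belongs to `q`, because added edges avoid the
    -- `H`-orbits of `q`.
    have hback : ∀ f ∈ F, Defined q (pos f) → ∀ y, (pos' f, y) ∈ q →
        ∃ x', (x', (h * y.1, y.2)) ∈ q ∧ ξ f = x' := by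
      intro f hf hdf y hy
      by_cases hx : ∃ x', (x', (h * y.1, y.2)) ∈ q'
      · obtain ⟨x', hx'⟩ := hx
        refine ⟨x', ?_, hd f hf y x' (hqq' hy) hx'⟩
        by_contra hno
        exact (hhair _ hx' hno).1 _ hy rfl
      · exact absurd (hd'' f hf hdf)
          (hc f hf y (hqq' hy) (fun x' hx' => hx ⟨x', hx'⟩) g hg)
    have hhair'' : ∀ e ∈ q'', e ∉ q →
        (∀ e₀ ∈ q, e.2.2 ≠ e₀.2.2) ∧ ∃ k : H, ∀ e' ∈ q'', e'.2 ≠ (k, e.2.2) := by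
      have hnew := he ?_
      · intro e he heq
        by_cases heq' : e ∈ q'
        · obtain ⟨h1, k, hk⟩ := hhair e heq' heq
          refine ⟨h1, k, fun e' he' hee => ?_⟩
          by_cases he'q : e' ∈ q'
          · exact hk e' he'q hee
          · exact (hnew e' he' he'q).1 e heq' (by rw [hee])
        · obtain ⟨h1, h2⟩ := hnew e he heq'
          exact ⟨fun e₀ he₀ => h1 e₀ (hqq' he₀), h2⟩
      · intro f hf y hy
        by_cases hdf : Defined q (pos f)
        · obtain ⟨y₀, hy₀⟩ := hin f hf hdf
          have hyy : y₀ = y := hq'.right_unique _ (hqq' hy₀) _ hy rfl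
          rw [hyy] at hy₀
          obtain ⟨x', hx', -⟩ := hback f hf hdf y hy₀
          exact ⟨x', hqq' hx'⟩
        · exact absurd ⟨y, hy⟩ (hout f hf hdf)
    refine ⟨q'', _, _, ⟨hqq'.trans hsub, hq'', hw'', hout'', ?_, hhair''⟩, ?_⟩
    · intro f hf hdf
      obtain ⟨y', hy'⟩ := hd'' f hf hdf
      by_contra hno
      -- A trapped point on an added edge could be moved to the free place `k` of its `H`-orbit, and
      -- then out of the domain by `g`.
      obtain ⟨-, k, hk⟩ := hhair'' _ hy' fun h1 => hno ⟨y', h1⟩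
      have hk1 : k * y'.1⁻¹ ≠ 1 := by
        intro h1
        rw [mul_inv_eq_one] at h1
        exact hk _ hy' (by rw [h1])
      obtain ⟨q₃, ζ, hsub₃, hq₃, hζ, hb₃, hc₃, -, -⟩ := hq''.exists_step hH hw'' hk1
      refine hc₃ f hf y' hy' (fun x' hx' => hk _ hx' ?_) g hg
        (hmax q₃ _ (fun f => (g * (ζ f).1, (ζ f).2)) (hqq'.trans (hsub.trans hsub₃)) hq₃
          (fun f hf => (hζ f hf).inl_mul g)
          (fun f hf h1 => (hb₃ f hf (hout'' f hf h1)).2 g hg) f hf hdf)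
      dsimp only
      rw [inv_mul_cancel_right]
    · intro f hf hdf y hy
      obtain ⟨x', hx', hxx⟩ := hback f hf hdf y hy
      exact ⟨x', hx', by rw [hxx]⟩
  obtain ⟨σ, hσ⟩ := hq.exists_extends
  -- The positions reachable from `f₀` form a finite set stable under all `gh` with `g` and `h`
  -- nontrivial, hence under `G` and `H`: this is a closed part of `q`, contradicting admissibility.
  set O : Set (G × ℕ) := {x | ∃ q' w' pos', Reach q' w' pos' ∧ pos' f₀ = x}
  have hOd : ∀ x ∈ O, (x, σ x) ∈ q := by
    rintro _ ⟨q', w', pos', hR, rfl⟩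
    obtain ⟨y, hy⟩ := hR.2.2.2.2.1 f₀ hf₀ hd₀
    have : σ (pos' f₀) = y := hσ _ hy
    rwa [this]
  have hOfin : O.Finite := (q.image Prod.fst).finite_toSet.subset fun x hx =>
    Finset.mem_coe.2 (Finset.mem_image_of_mem Prod.fst (hOd x hx))
  have hOinv : ∀ g : G, g ≠ 1 → ∀ h : H, h ≠ 1 → ∀ x ∈ O,
      (twistedHom σ).comp Coprod.inl g ((twistedHom σ).comp Coprod.inr h x) ∈ O := by
    intro g hg h hh x hx
    have hxσ := hOd x hx
    obtain ⟨q', w', pos', hR, rfl⟩ := hx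
    obtain ⟨q'', w'', pos'', hR', hpos⟩ := hstep q' w' pos' hR g hg h hh
    obtain ⟨x', hx', hxx⟩ := hpos f₀ hf₀ hd₀ _ hxσ
    refine ⟨q'', w'', pos'', hR', ?_⟩
    have h1 : σ x' = (h * (σ (pos' f₀)).1, (σ (pos' f₀)).2) := hσ _ hx'
    rw [MonoidHom.comp_apply, MonoidHom.comp_apply, twistedHom_inl, twistedHom_inr, ← h1,
      Equiv.symm_apply_apply, hxx]
  obtain ⟨hOG, hOH⟩ := invariant_of_mapsTo_mul hH _ _ hOfin hOinv
  refine hq.not_closed (q.filter fun e => e.1 ∈ O) (Finset.filter_subset _ _) ?_ ?_ ?_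
  · have h1 : pos f₀ ∈ O :=
      ⟨q, w, pos, ⟨subset_rfl, hq, hw, fun _ _ h => h, fun _ _ h => h,
        fun e he h => absurd he h⟩, rfl⟩
    exact ⟨_, Finset.mem_filter.2 ⟨hOd _ h1, h1⟩⟩
  · intro e he g
    have h1 := hOG g e.1 (Finset.mem_filter.1 he).2
    exact ⟨_, Finset.mem_filter.2 ⟨hOd _ h1, h1⟩, rfl⟩
  · intro e he h
    have h1 := hOH h e.1 (Finset.mem_filter.1 he).2
    refine ⟨_, Finset.mem_filter.2 ⟨hOd _ h1, h1⟩, ?_⟩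
    have h2 : σ e.1 = e.2 := hσ e (Finset.mem_filter.1 he).1
    rw [MonoidHom.comp_apply, twistedHom_inr, h2, Equiv.apply_symm_apply]

open Classical in
/-- Every finite set can be moved outside of the domain of an extension. -/
theorem IsAdmissible.exists_escape (hH : ∀ a b : H, ∃ k, k ≠ a ∧ k ≠ b)
    {q : Finset ((G × ℕ) × (H × ℕ))} (hq : IsAdmissible q) (F : Finset (G × ℕ)) :
    ∃ q' : Finset ((G × ℕ) × (H × ℕ)), ∃ w : Coprod G H, ∃ pos : G × ℕ → G × ℕ,
      q ⊆ q' ∧ IsAdmissible q' ∧ (∀ f ∈ F, Forces q' w f (pos f)) ∧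
      ∀ f ∈ F, ¬ Defined q' (pos f) := by
  have key : ∀ n : ℕ, n ≤ F.card →
      ∃ q' : Finset ((G × ℕ) × (H × ℕ)), ∃ w : Coprod G H, ∃ pos : G × ℕ → G × ℕ,
        q ⊆ q' ∧ IsAdmissible q' ∧ (∀ f ∈ F, Forces q' w f (pos f)) ∧
        n ≤ (F.filter fun f => ¬ Defined q' (pos f)).card := by
    intro n
    induction n with
    | zero => exact fun _ => ⟨q, 1, id, subset_rfl, hq, fun f _ σ _ => by simp, Nat.zero_le _⟩
    | succ n ih =>
      intro hn
      obtain ⟨q', w, pos, h1, h2, h3, h4⟩ := ih (by omega)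
      by_cases hall : ∃ f₀ ∈ F, Defined q' (pos f₀)
      · obtain ⟨f₀, hf₀, hd₀⟩ := hall
        obtain ⟨q'', w', pos', h5, h6, h7, h8, f, hf, hd, hd'⟩ :=
          h2.exists_escape_more hH h3 hf₀ hd₀
        refine ⟨q'', w', pos', h1.trans h5, h6, h7, Nat.succ_le_of_lt (h4.trans_lt ?_)⟩
        refine Finset.card_lt_card (Finset.ssubset_iff_of_subset ?_ |>.2 ⟨f, ?_, ?_⟩)
        · intro f hf
          rw [Finset.mem_filter] at hf ⊢
          exact ⟨hf.1, h8 f hf.1 hf.2⟩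
        · exact Finset.mem_filter.2 ⟨hf, hd'⟩
        · exact fun h => (Finset.mem_filter.1 h).2 hd
      · refine ⟨q', w, pos, h1, h2, h3, ?_⟩
        rwa [Finset.filter_true_of_mem (p := fun f => ¬ Defined q' (pos f))
          fun f hf hd => hall ⟨f, hf, hd⟩]
  obtain ⟨q', w, pos, h1, h2, h3, h4⟩ := key _ le_rfl
  refine ⟨q', w, pos, h1, h2, h3, fun f hf => ?_⟩
  rw [← Finset.eq_of_subset_of_card_le (Finset.filter_subset _ _) h4] at hf
  exact (Finset.mem_filter.1 hf).2

open Classical in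
/-- Any tuple of distinct points can be forced to be mapped to any disjoint tuple. -/
theorem IsAdmissible.exists_link (hH : ∀ a b : H, ∃ k, k ≠ a ∧ k ≠ b)
    {q : Finset ((G × ℕ) × (H × ℕ))} (hq : IsAdmissible q) {k : ℕ} (x : Fin k ⊕ Fin k → G × ℕ)
    (hx : Injective x) :
    ∃ q', q ⊆ q' ∧ IsAdmissible q' ∧
      ∃ w : Coprod G H, ∀ i, Forces q' w (x (.inl i)) (x (.inr i)) := by
  obtain ⟨q₁, w, pos, hqq₁, hq₁, hw, hout⟩ := hq.exists_escape hH (Finset.univ.image x)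
  have hmem : ∀ s, x s ∈ Finset.univ.image x := fun s =>
    Finset.mem_image_of_mem _ (Finset.mem_univ s)
  have hpos : Injective fun s => pos (x s) := by
    obtain ⟨σ, hσ⟩ := hq₁.exists_extends
    intro s t hst
    dsimp only at hst
    rw [← hw _ (hmem s) σ hσ, ← hw _ (hmem t) σ hσ] at hst
    exact hx ((twistedHom σ w).injective hst)
  obtain ⟨n, hn⟩ := exists_fresh q₁
  obtain ⟨h, hh⟩ := exists_ne (1 : H)
  -- The two points of each pair go to the same fresh `H`-orbit and differ by `h`; a third element
  -- of `H` keeps that orbit from being exhausted.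
  let y : Fin k ⊕ Fin k → H × ℕ := Sum.elim (fun i => (1, n + i)) (fun i => (h, n + i))
  have hy : Injective y := by
    rintro (i | i) (j | j) hij <;> simp_all [y, Fin.ext_iff, hh.symm]
  have hy2 : ∀ s, n ≤ (y s).2 := by rintro (i | i) <;> simp [y]
  let N : Finset ((G × ℕ) × (H × ℕ)) := Finset.univ.image fun s => (pos (x s), y s)
  have hN : ∀ e ∈ N, ∃ s, (pos (x s), y s) = e := fun e he => by simpa [N] using he
  have hNmem : ∀ s, (pos (x s), y s) ∈ N := fun s =>
    Finset.mem_image_of_mem (fun s => (pos (x s), y s)) (Finset.mem_univ s)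
  have hadm : IsAdmissible (q₁ ∪ N) := by
    refine hq₁.union ?_ ?_ ?_ ?_
    · intro a ha b hb
      obtain ⟨s, rfl⟩ := hN a ha
      obtain ⟨t, rfl⟩ := hN b hb
      exact hpos.eq_iff.trans hy.eq_iff.symm
    · intro e he e' he' hee
      obtain ⟨s, rfl⟩ := hN e he
      exact hout _ (hmem s) ⟨e'.2, by rw [show pos (x s) = e'.1 from hee]; exact he'⟩
    · intro e he e' he' hee
      obtain ⟨s, rfl⟩ := hN e he
      have h1 := hy2 s
      have h2 := (hn e' he').2
      dsimp only at hee
      omega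
    · intro e he
      obtain ⟨l, hl1, hlh⟩ := hH 1 h
      refine ⟨l, fun e' he' hee => ?_⟩
      obtain ⟨s, rfl⟩ := hN e' he'
      rcases s with i | i
      · exact hl1 (congrArg Prod.fst hee).symm
      · exact hlh (congrArg Prod.fst hee).symm
  refine ⟨q₁ ∪ N, hqq₁.trans Finset.subset_union_left, hadm, w⁻¹ * Coprod.inr h * w, ?_⟩
  intro i σ hσ
  have h1 := hw _ (hmem (.inl i)) σ (hσ.mono Finset.subset_union_left)
  have h2 := hw _ (hmem (.inr i)) σ (hσ.mono Finset.subset_union_left)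
  have h3 : σ (pos (x (.inl i))) = (1, n + i) := hσ _ (Finset.mem_union_right _ (hNmem (.inl i)))
  have h4 : σ (pos (x (.inr i))) = (h, n + i) := hσ _ (Finset.mem_union_right _ (hNmem (.inr i)))
  rw [map_mul, map_mul, Equiv.Perm.mul_apply, Equiv.Perm.mul_apply, h1, twistedHom_inr, h3, mul_one,
    ← h4, Equiv.symm_apply_apply, map_inv, ← h2]
  exact Equiv.symm_apply_apply _ _

end Link

/-! ### Reduced words in a free product. -/

section Reduced

variable {G : Type u} {H : Type v} [Group G] [Group H]

/-- Nonempty alternating products of nontrivial elements of `G` and `H`, where the first factor is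
in `G` if the parameter is `true` and in `H` otherwise. -/
inductive IsReducedWord : Bool → Coprod G H → Prop
  | inl {g : G} (hg : g ≠ 1) : IsReducedWord true (Coprod.inl g)
  | inr {h : H} (hh : h ≠ 1) : IsReducedWord false (Coprod.inr h)
  | inl_mul {g : G} {w : Coprod G H} (hg : g ≠ 1) (hw : IsReducedWord false w) :
      IsReducedWord true (Coprod.inl g * w)
  | inr_mul {h : H} {w : Coprod G H} (hh : h ≠ 1) (hw : IsReducedWord true w) :
      IsReducedWord false (Coprod.inr h * w)

theorem eq_one_or_isReducedWord (w : Coprod G H) : w = 1 ∨ ∃ b, IsReducedWord b w := by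
  induction w using Coprod.induction_on' with
  | one => exact Or.inl rfl
  | inl_mul g w ih =>
    by_cases hg : g = 1
    · simpa [hg] using ih
    rcases ih with rfl | ⟨b, hw⟩
    · rw [mul_one]
      exact Or.inr ⟨_, .inl hg⟩
    cases hw with
    | @inl g' hg' =>
      rw [← map_mul]
      by_cases h : g * g' = 1
      · exact Or.inl (by rw [h, map_one])
      · exact Or.inr ⟨_, .inl h⟩
    | @inl_mul g' _ hg' hw' =>
      rw [← mul_assoc, ← map_mul]
      by_cases h : g * g' = 1
      · rw [h, map_one, one_mul]
        exact Or.inr ⟨_, hw'⟩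
      · exact Or.inr ⟨_, .inl_mul h hw'⟩
    | inr hh => exact Or.inr ⟨_, .inl_mul hg (.inr hh)⟩
    | inr_mul hh hw' => exact Or.inr ⟨_, .inl_mul hg (.inr_mul hh hw')⟩
  | inr_mul h w ih =>
    by_cases hh : h = 1
    · simpa [hh] using ih
    rcases ih with rfl | ⟨b, hw⟩
    · rw [mul_one]
      exact Or.inr ⟨_, .inr hh⟩
    cases hw with
    | @inr h₀ hh' =>
      rw [← map_mul]
      by_cases h' : h * h₀ = 1
      · exact Or.inl (by rw [h', map_one])
      · exact Or.inr ⟨_, .inr h'⟩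
    | @inr_mul h₀ _ hh' hw' =>
      rw [← mul_assoc, ← map_mul]
      by_cases h' : h * h₀ = 1
      · rw [h', map_one, one_mul]
        exact Or.inr ⟨_, hw'⟩
      · exact Or.inr ⟨_, .inr_mul h' hw'⟩
    | inl hg => exact Or.inr ⟨_, .inr_mul hh (.inl hg)⟩
    | inl_mul hg hw' => exact Or.inr ⟨_, .inr_mul hh (.inl_mul hg hw')⟩

theorem injective_of_isReducedWord {K : Type*} [Group K] (φ : Coprod G H →* K)
    (hφ : ∀ b w, IsReducedWord b w → φ w ≠ 1) : Injective φ :=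
  (injective_iff_map_eq_one φ).2 fun w hw =>
    (eq_one_or_isReducedWord w).resolve_right fun ⟨b, hb⟩ => hφ b w hb hw

end Reduced

/-! ### Faithfulness and high transitivity of a generic action. -/

section Generic

variable {G : Type u} {H : Type v} [Group G] [Group H] [Countable G] [Countable H]
  [Nontrivial G] [Nontrivial H]

open Classical in
/-- Every reduced word can be forced to act nontrivially. -/
theorem IsReducedWord.exists_forces_ne (hH : ∀ a b : H, ∃ k, k ≠ a ∧ k ≠ b) {b : Bool}
    {w : Coprod G H} (hw : IsReducedWord b w) {q : Finset ((G × ℕ) × (H × ℕ))} (hq : IsAdmissible q) :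
    ∃ q', q ⊆ q' ∧ IsAdmissible q' ∧ ∃ f x, Forces q' w f x ∧ x ≠ f ∧ (∃ e ∈ q', e.1.2 = f.2) ∧
      (b = true → ¬ Defined q' x) ∧
      (b = false → x.2 ≠ f.2 ∧ ∀ g : G, g ≠ 1 → ¬ Defined q' (g * x.1, x.2)) := by
  have hstart : ∃ q' : Finset ((G × ℕ) × (H × ℕ)), q ⊆ q' ∧ IsAdmissible q' ∧ ∃ n : ℕ,
      Defined q' (1, n) ∧ ∀ g : G, g ≠ 1 → ¬ Defined q' (g, n) := by
    obtain ⟨n, hn⟩ := exists_fresh q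
    obtain ⟨N, h1, h2, h3⟩ := hq.exists_cross {(1, n)}
    refine ⟨q ∪ N, Finset.subset_union_left, h1, n, h2 _ (Finset.mem_singleton_self _), ?_⟩
    rintro g hg ⟨y, hy⟩
    rcases Finset.mem_union.1 hy with hy | hy
    · exact lt_irrefl _ (hn _ hy).1
    · exact hg (congrArg Prod.fst (Finset.mem_singleton.1 (h3 _ hy).1))
  -- Since the `G`-orbit of `f` already meets the partial bijection, the fresh orbit reached by `h`
  -- differs from it. The word thus cannot return to `f`.
  have hstep : ∀ {q' : Finset ((G × ℕ) × (H × ℕ))} {h : H} {w : Coprod G H} {f x}, h ≠ 1 →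
      q ⊆ q' → IsAdmissible q' → Forces q' w f x → (∃ e ∈ q', e.1.2 = f.2) → ¬ Defined q' x →
      ∃ q', q ⊆ q' ∧ IsAdmissible q' ∧ ∃ f x, Forces q' (Coprod.inr h * w) f x ∧ x ≠ f ∧
        (∃ e ∈ q', e.1.2 = f.2) ∧ (false = true → ¬ Defined q' x) ∧
        (false = false → x.2 ≠ f.2 ∧ ∀ g : G, g ≠ 1 → ¬ Defined q' (g * x.1, x.2)) := by
    intro q' h w f x hh hsub hq' hf he hx
    obtain ⟨q'', ξ, h1, h2, h3, h4, -, -, -⟩ := hq'.exists_step hH (F := {f}) (pos := fun _ => x)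
      (w := w) (by simpa using hf) hh
    obtain ⟨h5, h6⟩ := h4 f (by simp) hx
    obtain ⟨e, he, hef⟩ := he
    have hne : (ξ f).2 ≠ f.2 := fun h => h5 e he (hef.trans h.symm)
    exact ⟨q'', hsub.trans h1, h2, f, ξ f, h3 f (by simp), fun h => hne (by rw [h]),
      ⟨e, h1 he, hef⟩, by simp, fun _ => ⟨hne, h6⟩⟩
  induction hw with
  | @inl g hg =>
    obtain ⟨q', h1, h2, n, ⟨y, hy⟩, h4⟩ := hstart
    refine ⟨q', h1, h2, (1, n), (g, n), fun σ _ => by simp, by simpa using hg, ⟨_, hy, rfl⟩,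
      fun _ => h4 g hg, by simp⟩
  | @inr h hh =>
    obtain ⟨q', h1, h2, n, ⟨y, hy⟩, h4⟩ := hstart
    obtain ⟨g, hg⟩ := exists_ne (1 : G)
    have := hstep (w := 1) (f := (g, n)) (x := (g, n)) hh h1 h2 (fun σ _ => by simp) ⟨_, hy, rfl⟩
      (h4 g hg)
    rwa [mul_one] at this
  | @inl_mul g w hg _ ih =>
    obtain ⟨q', h1, h2, f, x, h3, -, h4, -, h5⟩ := ih
    refine ⟨q', h1, h2, f, _, h3.inl_mul g,
      fun h => (h5 rfl).1 (by rw [← h]), h4,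
      fun _ => (h5 rfl).2 g hg, by simp⟩
  | @inr_mul h w hh _ ih =>
    obtain ⟨q', h1, h2, f, x, h3, -, h4, h5, -⟩ := ih
    exact hstep hh h1 h2 h3 h4 (h5 rfl)

variable (G H) in
/-- If `H` has at least three elements, then `G ∗ H` acts faithfully and highly transitively on
`G × ℕ`. -/
theorem exists_injective_highlyTransitive (hH : ∀ a b : H, ∃ k, k ≠ a ∧ k ≠ b) :
    ∃ φ : Coprod G H →* Equiv.Perm (G × ℕ), Injective φ ∧
      ∀ (k : ℕ) (x y : Fin k ↪ G × ℕ), ∃ w, ∀ i, φ w (x i) = y i := by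
  classical
  have : Countable (Coprod G H) := Coprod.mk_surjective.countable
  let D : Coprod G H ⊕ (Σ k : ℕ, Fin k ⊕ Fin k → G × ℕ) → Finset ((G × ℕ) × (H × ℕ)) → Prop
    | .inl w, q => (∃ b, IsReducedWord b w) → ∃ f x, Forces q w f x ∧ x ≠ f
    | .inr ⟨_, x⟩, q => Injective x → ∃ w : Coprod G H, ∀ i, Forces q w (x (.inl i)) (x (.inr i))
  obtain ⟨σ, -, hσ⟩ := (isAdmissible_empty (G := G) (H := H)).exists_generic D (by
    rintro (w | ⟨k, x⟩) q hq
    · by_cases hw : ∃ b, IsReducedWord b w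
      · obtain ⟨b, hb⟩ := hw
        obtain ⟨q', h1, h2, f, x, h3, h4, -⟩ := hb.exists_forces_ne hH hq
        exact ⟨q', h1, h2, fun _ => ⟨f, x, h3, h4⟩⟩
      · exact ⟨q, subset_rfl, hq, fun h => absurd h hw⟩
    · by_cases hx : Injective x
      · obtain ⟨q', h1, h2, h3⟩ := hq.exists_link hH x hx
        exact ⟨q', h1, h2, fun _ => h3⟩
      · exact ⟨q, subset_rfl, hq, fun h => absurd h hx⟩)
  have hdisj : ∀ (k : ℕ) (x y : Fin k → G × ℕ), Injective (Sum.elim x y) →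
      ∃ w, ∀ i, twistedHom σ w (x i) = y i := by
    intro k x y hxy
    obtain ⟨q, hq, hqσ⟩ := hσ (.inr ⟨k, Sum.elim x y⟩)
    obtain ⟨w, hw⟩ := hq hxy
    exact ⟨w, fun i => hw i σ hqσ⟩
  refine ⟨twistedHom σ, injective_of_isReducedWord _ fun b w hw h1 => ?_, fun k x y => ?_⟩
  · obtain ⟨q, hq, hqσ⟩ := hσ (.inl w)
    obtain ⟨f, x, h2, h3⟩ := hq ⟨b, hw⟩
    have := h2 σ hqσ
    rw [h1] at this
    exact h3 this.symm
  · obtain ⟨n, hn⟩ : ∃ n, ∀ i, (x i).2 < n ∧ (y i).2 < n := by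
      refine ⟨Finset.univ.sup (fun i => (x i).2) + Finset.univ.sup (fun i => (y i).2) + 1,
        fun i => ?_⟩
      have h1 := Finset.le_sup (f := fun i => (x i).2) (Finset.mem_univ i)
      have h2 := Finset.le_sup (f := fun i => (y i).2) (Finset.mem_univ i)
      omega
    -- Only disjoint tuples have been linked, so overlapping ones are joined through a third tuple
    -- disjoint from both.
    let z : Fin k → G × ℕ := fun i => (1, n + i)
    have hz : Injective z := fun i j hij => by simpa [z, Fin.ext_iff] using hij
    obtain ⟨w₁, hw₁⟩ := hdisj k x z (x.injective.sumElim hz fun i j h => by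
      have h1 := (hn i).1
      rw [h] at h1
      exact absurd h1 (by simp [z]))
    obtain ⟨w₂, hw₂⟩ := hdisj k z y (hz.sumElim y.injective fun i j h => by
      have h1 := (hn j).2
      rw [← h] at h1
      exact absurd h1 (by simp [z]))
    exact ⟨w₂ * w₁, fun i => by rw [map_mul, Equiv.Perm.mul_apply, hw₁, hw₂]⟩

end Generic

/-! ### Transfer of actions, and the obstruction from the center. -/

section Transfer

theorem admitsFaithfulHighlyTransitiveAction_of_hom {Γ X : Type*} [Group Γ] [Countable X]
    [Infinite X] (φ : Γ →* Equiv.Perm X) (hφ : Injective φ)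
    (ht : ∀ (k : ℕ) (x y : Fin k ↪ X), ∃ w, ∀ i, φ w (x i) = y i) :
    AdmitsFaithfulHighlyTransitiveAction Γ := by
  obtain ⟨_⟩ := nonempty_denumerable X
  let e : X ≃ ℕ := Denumerable.eqv X
  let ψ : Γ →* Equiv.Perm ℕ := e.permCongrHom.toMonoidHom.comp φ
  have hψ : ∀ w n, ψ w n = e (φ w (e.symm n)) := fun _ _ => rfl
  let _ : MulAction Γ ℕ := MulAction.compHom ℕ ψ
  have hsmul : ∀ (w : Γ) (n : ℕ), w • n = ψ w n := fun _ _ => rfl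
  refine ⟨ℕ, inferInstance, inferInstance, inferInstance, ⟨fun {a b} h => ?_⟩, fun k _ => ⟨?_⟩⟩
  · exact hφ (e.permCongrHom.injective (Equiv.ext h))
  · intro x y
    obtain ⟨w, hw⟩ := ht k (x.trans e.symm.toEmbedding) (y.trans e.symm.toEmbedding)
    refine ⟨w, DFunLike.ext _ _ fun i => ?_⟩
    have h1 : φ w (e.symm (x i)) = e.symm (y i) := hw i
    rw [Function.Embedding.smul_apply, hsmul, hψ, h1, e.apply_symm_apply]

theorem AdmitsHighlyTransitiveAction.of_surjective {Γ Γ' : Type*} [Group Γ] [Group Γ']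
    (h : AdmitsHighlyTransitiveAction Γ') (π : Γ →* Γ') (hπ : Surjective π) :
    AdmitsHighlyTransitiveAction Γ := by
  obtain ⟨X, hc, hi, _, ht⟩ := h
  let _ : MulAction Γ X := MulAction.compHom X π
  refine ⟨X, hc, hi, inferInstance, fun k hk => ⟨fun x y => ?_⟩⟩
  obtain ⟨w, hw⟩ := (ht k hk).exists_smul_eq x y
  obtain ⟨w, rfl⟩ := hπ w
  exact ⟨w, hw⟩

theorem AdmitsFaithfulHighlyTransitiveAction.of_mulEquiv {Γ Γ' : Type*} [Group Γ] [Group Γ']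
    (h : AdmitsFaithfulHighlyTransitiveAction Γ') (e : Γ ≃* Γ') :
    AdmitsFaithfulHighlyTransitiveAction Γ := by
  obtain ⟨X, hc, hi, _, hf, ht⟩ := h
  let _ : MulAction Γ X := MulAction.compHom X e.toMonoidHom
  refine ⟨X, hc, hi, inferInstance, ⟨fun {a b} h => ?_⟩, fun k hk => ⟨fun x y => ?_⟩⟩
  · exact e.injective (hf.eq_of_smul_eq_smul h)
  · obtain ⟨w, hw⟩ := (ht k hk).exists_smul_eq x y
    obtain ⟨w, rfl⟩ := e.surjective w
    exact ⟨w, hw⟩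

theorem AdmitsFaithfulHighlyTransitiveAction.admits {Γ : Type*} [Group Γ]
    (h : AdmitsFaithfulHighlyTransitiveAction Γ) : AdmitsHighlyTransitiveAction Γ := by
  obtain ⟨X, hc, hi, ha, -, ht⟩ := h
  exact ⟨X, hc, hi, ha, ht⟩

theorem IsHighlyTransitive.exists_smul_eq {Γ X : Type*} [Group Γ] [MulAction Γ X]
    (h : IsHighlyTransitive Γ X) {k : ℕ} [NeZero k] {x y : Fin k → X} (hx : Injective x)
    (hy : Injective y) : ∃ w : Γ, ∀ i, w • x i = y i := by
  obtain ⟨w, hw⟩ := (h k (NeZero.pos k)).exists_smul_eq ⟨x, hx⟩ ⟨y, hy⟩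
  exact ⟨w, fun i => DFunLike.congr_fun hw i⟩

/-- A group with a faithful highly transitive action on an infinite set has trivial center. -/
theorem not_admitsFaithfulHighlyTransitiveAction_of_mem_center {Γ : Type*} [Group Γ] {c : Γ}
    (hc : c ∈ Subgroup.center Γ) (hc1 : c ≠ 1) : ¬ AdmitsFaithfulHighlyTransitiveAction Γ := by
  rintro ⟨X, -, _, _, hf, ht⟩
  obtain ⟨x, hx⟩ : ∃ x : X, c • x ≠ x := by
    by_contra! h
    exact hc1 (hf.eq_of_smul_eq_smul fun x => by rw [h, one_smul])
  obtain ⟨z, hz⟩ := Infinite.exists_notMem_finset ({x, c • x} : Set X).toFinite.toFinset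
  simp only [Set.Finite.mem_toFinset, Set.mem_insert_iff, Set.mem_singleton_iff, not_or] at hz
  -- Anything fixing `x` commutes with `c`, hence fixes `c • x`; double transitivity violates this.
  obtain ⟨w, hw⟩ := ht.exists_smul_eq (x := ![x, c • x]) (y := ![x, z])
    (by simpa [Function.Injective, Fin.forall_fin_two, eq_comm] using hx)
    (by simpa [Function.Injective, Fin.forall_fin_two, eq_comm] using hz.1)
  have h0 : w • x = x := hw 0
  have h1 : w • c • x = z := hw 1
  rw [← mul_smul, Subgroup.mem_center_iff.1 hc, mul_smul, h0] at h1
  exact hz.2 h1.symm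

end Transfer

/-! ### The infinite dihedral group. -/

section Dihedral

variable {G : Type u} {H : Type v} [Group G] [Group H]

theorem exists_forall_eq_one_or_eq (e : G ≃* CyclicGroup 2) : ∃ a : G, ∀ g, g = 1 ∨ g = a := by
  refine ⟨e.symm (Multiplicative.ofAdd 1), fun g => ?_⟩
  have h : ∀ c : ZMod 2, c = 0 ∨ c = 1 := by decide
  rcases h (e g).toAdd with h | h
  · exact Or.inl (e.injective (h.trans (map_one e).symm))
  · exact Or.inr (e.eq_symm_apply.2 h)

theorem mul_self_eq_one_of_forall {a : G} (ha : ∀ g, g = 1 ∨ g = a) : a * a = 1 := by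
  rcases ha a⁻¹ with h | h
  · rw [inv_eq_one.1 h, mul_one]
  · nth_rw 1 [← h]
    exact inv_mul_cancel a

/-- The elements of a free product of two groups of order two are rotations or reflections. -/
theorem exists_zpow_of_forall {a : G} {b : H} (ha : ∀ g, g = 1 ∨ g = a) (hb : ∀ h, h = 1 ∨ h = b)
    (w : Coprod G H) :
    (∃ n : ℤ, w = (Coprod.inl a * Coprod.inr b) ^ n) ∨ w * w = 1 := by
  set A : Coprod G H := Coprod.inl a
  set B : Coprod G H := Coprod.inr b
  have hA : A * A = 1 := by rw [← map_mul, mul_self_eq_one_of_forall ha, map_one]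
  have hB : B * B = 1 := by rw [← map_mul, mul_self_eq_one_of_forall hb, map_one]
  have hA' : A⁻¹ = A := inv_eq_of_mul_eq_one_left hA
  have hB' : B⁻¹ = B := inv_eq_of_mul_eq_one_left hB
  have hconj : ∀ n : ℤ, A * (A * B) ^ n = (A * B) ^ (-n) * A := by
    intro n
    have h1 : A * (A * B) * A⁻¹ = (A * B)⁻¹ := by
      rw [mul_inv_rev, hA', hB', ← mul_assoc, hA, one_mul]
    rw [zpow_neg, ← inv_zpow, ← h1, conj_zpow, inv_mul_cancel_right]
  have key : (∃ n : ℤ, w = (A * B) ^ n) ∨ ∃ n : ℤ, w = (A * B) ^ n * A := by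
    have hmulA : ∀ w, ((∃ n : ℤ, w = (A * B) ^ n) ∨ ∃ n : ℤ, w = (A * B) ^ n * A) →
        (∃ n : ℤ, A * w = (A * B) ^ n) ∨ ∃ n : ℤ, A * w = (A * B) ^ n * A := by
      rintro w (⟨n, rfl⟩ | ⟨n, rfl⟩)
      · exact Or.inr ⟨-n, hconj n⟩
      · exact Or.inl ⟨-n, by rw [← mul_assoc, hconj, mul_assoc, hA, mul_one]⟩
    induction w using Coprod.induction_on' with
    | one => exact Or.inl ⟨0, by rw [zpow_zero]⟩
    | inl_mul g w ih =>
      rcases ha g with rfl | rfl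
      · simpa using ih
      · exact hmulA w ih
    | inr_mul h w ih =>
      rcases hb h with rfl | rfl
      · simpa using ih
      · have h1 : B * w = A * ((A * B) * w) := by
          rw [← mul_assoc, ← mul_assoc A A, hA, one_mul]
        change (∃ n : ℤ, B * w = _) ∨ ∃ n : ℤ, B * w = _
        rw [h1]
        refine hmulA _ ?_
        rcases ih with ⟨n, rfl⟩ | ⟨n, rfl⟩
        · exact Or.inl ⟨1 + n, by rw [zpow_one_add]⟩
        · exact Or.inr ⟨1 + n, by rw [zpow_one_add, mul_assoc _ _ A]⟩
  refine key.imp_right ?_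
  rintro ⟨n, rfl⟩
  rw [mul_assoc, ← mul_assoc A, hconj, mul_assoc _ A A, hA, mul_one, ← zpow_add, add_neg_cancel,
    zpow_zero]

/-- Some `w` fixes `x`, sends `y` to `z` and `z` to `z' ≠ y`. The last two conditions exclude `w * w
= 1`; with `y = t • x`, or with `t` acting trivially, a power of `t` fixing `x` also fixes `y`. -/
theorem not_admitsFaithfulHighlyTransitiveAction_coprod (e : G ≃* CyclicGroup 2)
    (e' : H ≃* CyclicGroup 2) : ¬ AdmitsFaithfulHighlyTransitiveAction (Coprod G H) := by
  rintro ⟨X, -, _, _, -, ht⟩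
  obtain ⟨a, ha⟩ := exists_forall_eq_one_or_eq e
  obtain ⟨b, hb⟩ := exists_forall_eq_one_or_eq e'
  set t : Coprod G H := Coprod.inl a * Coprod.inr b
  obtain ⟨x, y, hxy, hrot⟩ : ∃ x y : X, x ≠ y ∧ ∀ n : ℤ, t ^ n • x = x → t ^ n • y = y := by
    by_cases htriv : ∃ x : X, t • x ≠ x
    · obtain ⟨x, hx⟩ := htriv
      refine ⟨x, t • x, hx.symm, fun n hn => ?_⟩
      rw [← mul_smul, ← zpow_add_one, zpow_add_one, ((Commute.refl t).zpow_left n).eq, mul_smul, hn]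
    · push Not at htriv
      obtain ⟨x, y, hxy⟩ := exists_pair_ne X
      exact ⟨x, y, hxy, fun n _ => (MulAction.stabilizer _ y).zpow_mem (htriv y) n⟩
  obtain ⟨z, hz⟩ := Infinite.exists_notMem_finset ({x, y} : Set X).toFinite.toFinset
  obtain ⟨z', hz'⟩ := Infinite.exists_notMem_finset ({x, y, z} : Set X).toFinite.toFinset
  simp only [Set.Finite.mem_toFinset, Set.mem_insert_iff, Set.mem_singleton_iff, not_or] at hz hz'
  obtain ⟨w, hw⟩ := ht.exists_smul_eq (x := ![x, y, z]) (y := ![x, z, z'])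
    (by
      intro i j hij
      fin_cases i <;> fin_cases j <;> simp_all [eq_comm])
    (by
      intro i j hij
      fin_cases i <;> fin_cases j <;> simp_all [eq_comm])
  have h0 : w • x = x := hw 0
  have h1 : w • y = z := hw 1
  have h2 : w • z = z' := hw 2
  rcases exists_zpow_of_forall ha hb w with ⟨n, rfl⟩ | hw2
  · exact hz.2 (h1.symm.trans (hrot n h0))
  · rw [← h1, ← mul_smul, hw2, one_smul] at h2
    exact hz'.2.1 h2.symm

end Dihedral

/-! ### The criterion for free products. -/

section FreeProduct

theorem forall_exists_ne_ne {H : Type*} [Group H] [Nontrivial H]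
    (h : ¬ Nonempty (H ≃* CyclicGroup 2)) : ∀ a b : H, ∃ k, k ≠ a ∧ k ≠ b := by
  by_contra! hcon
  obtain ⟨a, b, hab⟩ := hcon
  have hab' : ∀ k, k = a ∨ k = b := fun k => or_iff_not_imp_left.2 (hab k)
  have hne : a ≠ b := by
    rintro rfl
    obtain ⟨x, y, hxy⟩ := exists_pair_ne H
    exact hxy (((hab' x).elim id id).trans ((hab' y).elim id id).symm)
  have hcard : Nat.card H = 2 := Nat.card_eq_two_iff.2 ⟨a, b, hne, by ext k; simpa using hab' k⟩
  have : Fact (Nat.Prime 2) := ⟨Nat.prime_two⟩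
  exact h ⟨mulEquivOfPrimeCardEq (p := 2) hcard (by simp [Nat.card_eq_fintype_card])⟩

variable (G : Type u) (H : Type v) [Group G] [Group H] [Nontrivial G] [Nontrivial H]
  [Countable G] [Countable H]

theorem admitsFaithfulHighlyTransitiveAction_coprod (h : ¬ Nonempty (H ≃* CyclicGroup 2)) :
    AdmitsFaithfulHighlyTransitiveAction (Coprod G H) := by
  obtain ⟨φ, hφ, ht⟩ := exists_injective_highlyTransitive G H (forall_exists_ne_ne h)
  exact admitsFaithfulHighlyTransitiveAction_of_hom φ hφ ht

theorem admitsFaithfulHighlyTransitiveAction_coprod_iff :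
    AdmitsFaithfulHighlyTransitiveAction (Coprod G H) ↔
      (¬ Nonempty (G ≃* CyclicGroup 2) ∨ ¬ Nonempty (H ≃* CyclicGroup 2)) := by
  constructor
  · intro h
    by_contra! hcon
    obtain ⟨⟨e⟩, ⟨e'⟩⟩ := hcon
    exact not_admitsFaithfulHighlyTransitiveAction_coprod e e' h
  · rintro (h | h)
    · exact (admitsFaithfulHighlyTransitiveAction_coprod H G h).of_mulEquiv
        (MulEquiv.coprodComm G H)
    · exact admitsFaithfulHighlyTransitiveAction_coprod G H h

end FreeProduct

/-! ### The modular group as a free product. -/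

section ProjectiveSpecialLinear

open Matrix

/-- The homomorphism from the cyclic group of order `n` given by an element of order dividing
`n`. -/
def cyclicLift {K : Type*} [Group K] (n : ℕ) (k : K) (hk : k ^ n = 1) : CyclicGroup n →* K :=
  AddMonoidHom.toMultiplicativeLeft
    (ZMod.lift n ⟨zmultiplesHom (Additive K) (Additive.ofMul k), by
      rw [zmultiplesHom_apply, natCast_zsmul, ← ofMul_pow, hk, ofMul_one]⟩)

theorem cyclicLift_ofAdd {K : Type*} [Group K] (n : ℕ) (k : K) (hk : k ^ n = 1) (i : ℤ) :
    cyclicLift n k hk (Multiplicative.ofAdd (i : ZMod n)) = k ^ i := by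
  change Additive.toMul (ZMod.lift n _ (i : ZMod n)) = k ^ i
  rw [ZMod.lift_coe, zmultiplesHom_apply, toMul_zsmul, toMul_ofMul]

/-- An element of order six of `SL(2, ℤ)`. -/
def modularB : SpecialLinearGroup (Fin 2) ℤ :=
  ⟨!![1, -1; 1, 0], by simp [Matrix.det_fin_two]⟩

theorem coe_modularB_sq :
    ((modularB ^ 2 : SpecialLinearGroup (Fin 2) ℤ) : Matrix (Fin 2) (Fin 2) ℤ) =
      !![0, -1; 1, -1] := by
  decide

theorem mk_neg_one : (QuotientGroup.mk (-1 : SpecialLinearGroup (Fin 2) ℤ) :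
    ProjectiveSpecialLinearGroup (Fin 2) ℤ) = 1 := by
  rw [QuotientGroup.eq_one_iff, Subgroup.mem_center_iff]
  intro g
  rw [mul_neg, neg_mul, one_mul, mul_one]

/-- The comparison homomorphism from the free product of the cyclic groups of orders `2` and `3` to
the modular group. -/
def modularHom :
    Coprod (CyclicGroup 2) (CyclicGroup 3) →* ProjectiveSpecialLinearGroup (Fin 2) ℤ :=
  Coprod.lift
    (cyclicLift 2 (QuotientGroup.mk ModularGroup.S) (by
      rw [← QuotientGroup.mk_pow, ← mk_neg_one, show ModularGroup.S ^ 2 = -1 by decide]))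
    (cyclicLift 3 (QuotientGroup.mk modularB) (by
      rw [← QuotientGroup.mk_pow, ← mk_neg_one, show modularB ^ 3 = -1 by decide]))

theorem modularHom_inl {c : CyclicGroup 2} (hc : c ≠ 1) :
    modularHom (Coprod.inl c) = QuotientGroup.mk ModularGroup.S := by
  have h : ∀ c : ZMod 2, c ≠ 0 → c = ((1 : ℤ) : ZMod 2) := by decide
  have hc' : c = Multiplicative.ofAdd ((1 : ℤ) : ZMod 2) := h c hc
  rw [hc', modularHom, Coprod.lift_apply_inl, cyclicLift_ofAdd, zpow_one]

theorem modularHom_inr {c : CyclicGroup 3} (hc : c ≠ 1) :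
    modularHom (Coprod.inr c) = QuotientGroup.mk modularB ∨
      modularHom (Coprod.inr c) = QuotientGroup.mk (modularB ^ 2) := by
  have h : ∀ c : ZMod 3, c ≠ 0 → c = ((1 : ℤ) : ZMod 3) ∨ c = ((2 : ℤ) : ZMod 3) := by decide
  have hc' : c = Multiplicative.ofAdd ((1 : ℤ) : ZMod 3) ∨
    c = Multiplicative.ofAdd ((2 : ℤ) : ZMod 3) := h c hc
  rcases hc' with hc' | hc'
  · left
    rw [hc', modularHom, Coprod.lift_apply_inr, cyclicLift_ofAdd, zpow_one]
  · right
    rw [hc', modularHom, Coprod.lift_apply_inr, cyclicLift_ofAdd, QuotientGroup.mk_pow]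
    rfl

/-- `S` and `T` generate `SL₂(ℤ)`, and `T` equals `modularB * S` up to sign. -/
theorem modularHom_surjective : Surjective modularHom := by
  have hS : QuotientGroup.mk ModularGroup.S ∈ modularHom.range :=
    ⟨Coprod.inl (Multiplicative.ofAdd ((1 : ℤ) : ZMod 2)), modularHom_inl (by decide)⟩
  have hB : QuotientGroup.mk modularB ∈ modularHom.range :=
    ⟨Coprod.inr (Multiplicative.ofAdd ((1 : ℤ) : ZMod 3)), by
      rw [modularHom, Coprod.lift_apply_inr, cyclicLift_ofAdd, zpow_one]⟩
  have hT : QuotientGroup.mk ModularGroup.T ∈ modularHom.range := by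
    have h : ModularGroup.T = -1 * (modularB * ModularGroup.S) := by decide
    rw [h, QuotientGroup.mk_mul, mk_neg_one, one_mul, QuotientGroup.mk_mul]
    exact mul_mem hB hS
  have hle : Subgroup.closure {ModularGroup.S, ModularGroup.T} ≤
      modularHom.range.comap (QuotientGroup.mk' _) := by
    rw [Subgroup.closure_le]
    rintro _ (rfl | rfl)
    · exact hS
    · exact hT
  intro x
  obtain ⟨M, rfl⟩ := QuotientGroup.mk_surjective x
  exact hle (by rw [SpecialLinearGroup.SL2Z_generators]; exact Subgroup.mem_top M)

/-- Reduced words act by ping-pong on vectors according to the sign of the product of the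
coordinates, with increasing norm. -/
theorem IsReducedWord.exists_modularHom_eq {b : Bool} {w : Coprod (CyclicGroup 2) (CyclicGroup 3)}
    (hw : IsReducedWord b w) :
    ∃ (M : SpecialLinearGroup (Fin 2) ℤ) (v u : Fin 2 → ℤ), modularHom w = QuotientGroup.mk M ∧
      (∀ i, |v i| = 1) ∧ M.1 *ᵥ v = u ∧
      (b = true → u 0 * u 1 < 0 ∧ (3 ≤ |u 0| + |u 1| ∨ 0 < v 0 * v 1)) ∧
      (b = false → 0 < u 0 * u 1 ∧ 3 ≤ |u 0| + |u 1|) := by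
  have hS : ∀ u : Fin 2 → ℤ, ModularGroup.S.1 *ᵥ u = ![-u 1, u 0] := by
    intro u
    ext i
    fin_cases i <;> simp [ModularGroup.S, Matrix.mulVec, dotProduct, Fin.sum_univ_two]
  have hB : ∀ u : Fin 2 → ℤ, modularB.1 *ᵥ u = ![u 0 - u 1, u 0] := by
    intro u
    ext i
    fin_cases i <;> simp [modularB, Matrix.mulVec, dotProduct, Fin.sum_univ_two, sub_eq_add_neg]
  have hB2 : ∀ u : Fin 2 → ℤ, (modularB ^ 2).1 *ᵥ u = ![-u 1, u 0 - u 1] := by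
    intro u
    rw [coe_modularB_sq]
    ext i
    fin_cases i <;> simp [Matrix.mulVec, dotProduct, Fin.sum_univ_two, sub_eq_add_neg]
  have hstep : ∀ {c : CyclicGroup 3} (_ : c ≠ 1) (w : Coprod (CyclicGroup 2) (CyclicGroup 3))
      (M : SpecialLinearGroup (Fin 2) ℤ) (v u : Fin 2 → ℤ), modularHom w = QuotientGroup.mk M →
      (∀ i, |v i| = 1) → M.1 *ᵥ v = u → u 0 * u 1 < 0 →
      ∃ (M : SpecialLinearGroup (Fin 2) ℤ) (v u : Fin 2 → ℤ),
        modularHom (Coprod.inr c * w) = QuotientGroup.mk M ∧ (∀ i, |v i| = 1) ∧ M.1 *ᵥ v = u ∧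
        (false = true → u 0 * u 1 < 0 ∧ (3 ≤ |u 0| + |u 1| ∨ 0 < v 0 * v 1)) ∧
        (false = false → 0 < u 0 * u 1 ∧ 3 ≤ |u 0| + |u 1|) := by
    intro c hc w M v u hM hv hu h1
    -- For coordinates of opposite signs, `u 0 - u 1` adds their absolute values. Both nontrivial
    -- powers therefore make the product positive and the norm at least 3.
    have key : (0 < (u 0 - u 1) * u 0 ∧ 3 ≤ |u 0 - u 1| + |u 0|) ∧
        (0 < -u 1 * (u 0 - u 1) ∧ 3 ≤ |-u 1| + |u 0 - u 1|) := by
      rcases mul_neg_iff.1 h1 with ⟨h2, h3⟩ | ⟨h2, h3⟩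
      · rw [abs_of_pos (by omega : 0 < u 0 - u 1), abs_of_pos h2, abs_of_pos (by omega : 0 < -u 1)]
        exact ⟨⟨mul_pos (by omega) h2, by omega⟩, mul_pos (by omega) (by omega), by omega⟩
      · rw [abs_of_neg (by omega : u 0 - u 1 < 0), abs_of_neg h2, abs_of_neg (by omega : -u 1 < 0)]
        exact ⟨⟨mul_pos_of_neg_of_neg (by omega) h2, by omega⟩,
          mul_pos_of_neg_of_neg (by omega) (by omega), by omega⟩
    rcases modularHom_inr hc with h | h
    · refine ⟨modularB * M, v, _, by rw [map_mul, h, hM, QuotientGroup.mk_mul], hv, rfl, by simp,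
        ?_⟩
      rw [Matrix.SpecialLinearGroup.coe_mul, ← Matrix.mulVec_mulVec, hu, hB]
      exact fun _ => key.1
    · refine ⟨modularB ^ 2 * M, v, _, by rw [map_mul, h, hM, QuotientGroup.mk_mul], hv, rfl,
        by simp, ?_⟩
      rw [Matrix.SpecialLinearGroup.coe_mul, ← Matrix.mulVec_mulVec, hu, hB2]
      exact fun _ => key.2
  induction hw with
  | inl hg =>
    -- The single letter `S` leaves the norm at 2; here only the sign change of the product of
    -- coordinates shows nontriviality.
    refine ⟨ModularGroup.S, ![1, 1], ![-1, 1], modularHom_inl hg, ?_, ?_, by simp, by simp⟩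
    · simp [Fin.forall_fin_two]
    · rw [hS]
      rfl
  | inr hh =>
    have := hstep hh 1 1 ![1, -1] ![1, -1] (by simp) (by simp [Fin.forall_fin_two]) (by simp)
      (by simp)
    rwa [mul_one] at this
  | inl_mul hg _ ih =>
    obtain ⟨M, v, u, hM, hv, hu, -, h⟩ := ih
    refine ⟨ModularGroup.S * M, v, _, by rw [map_mul, modularHom_inl hg, hM, QuotientGroup.mk_mul],
      hv, rfl, ?_, by simp⟩
    rw [Matrix.SpecialLinearGroup.coe_mul, ← Matrix.mulVec_mulVec, hu, hS]
    obtain ⟨h1, h2⟩ := h rfl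
    refine fun _ => ⟨?_, Or.inl ?_⟩
    · simpa [mul_comm] using h1
    · simpa [add_comm] using h2
  | inr_mul hh _ ih =>
    obtain ⟨M, v, u, hM, hv, hu, h, -⟩ := ih
    exact hstep hh _ M v u hM hv hu (h rfl).1

/-- A representative of the trivial class is a scalar `±1`, so it preserves both the norm 2 of `v`
and the product of its coordinates, against the ping-pong estimates. -/
theorem modularHom_injective : Injective modularHom := by
  refine injective_of_isReducedWord _ fun b w hw h1 => ?_
  obtain ⟨M, v, u, hM, hv, hu, ht, hf⟩ := hw.exists_modularHom_eq
  rw [hM, QuotientGroup.eq_one_iff, Matrix.SpecialLinearGroup.mem_center_iff] at h1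
  obtain ⟨r, hr, hrM⟩ := h1
  have hr : r ^ 2 = 1 := hr
  have hu' : ∀ i, u i = r * v i := by
    intro i
    rw [← hu, ← hrM]
    simp
  have hr1 : |r| = 1 := by
    rcases eq_or_eq_neg_of_sq_eq_sq r 1 (by rw [hr, one_pow]) with rfl | rfl <;> rfl
  have h3 : |u 0| + |u 1| = 2 := by
    rw [hu', hu', abs_mul, abs_mul, hv, hv, hr1]
    rfl
  have h4 : u 0 * u 1 = v 0 * v 1 := by
    rw [hu', hu']
    linear_combination (v 0 * v 1) * hr
  cases b with
  | false =>
    have := (hf rfl).2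
    omega
  | true =>
    obtain ⟨h5, h6 | h6⟩ := ht rfl
    · omega
    · omega

/-- The modular group is the free product of cyclic groups of orders `2` and `3`. -/
noncomputable def modularEquiv :
    ProjectiveSpecialLinearGroup (Fin 2) ℤ ≃* Coprod (CyclicGroup 2) (CyclicGroup 3) :=
  (MulEquiv.ofBijective modularHom ⟨modularHom_injective, modularHom_surjective⟩).symm

theorem neg_one_mem_center_and_ne_one :
    (-1 : SpecialLinearGroup (Fin 2) ℤ) ∈ Subgroup.center (SpecialLinearGroup (Fin 2) ℤ) ∧
      (-1 : SpecialLinearGroup (Fin 2) ℤ) ≠ 1 := by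
  refine ⟨(QuotientGroup.eq_one_iff _).1 mk_neg_one, fun h => ?_⟩
  have := congrArg (fun M : SpecialLinearGroup (Fin 2) ℤ => M.1 0 0) h
  simp at this

end ProjectiveSpecialLinear

theorem mainTheorem1 :
    (∀ (G : Type u) (H : Type v) [Group G] [Group H] [Nontrivial G] [Nontrivial H]
        [Countable G] [Countable H],
      AdmitsFaithfulHighlyTransitiveAction (Monoid.Coprod G H) ↔
        (¬ Nonempty (G ≃* CyclicGroup 2) ∨ ¬ Nonempty (H ≃* CyclicGroup 2))) ∧
    (Nonempty (Matrix.ProjectiveSpecialLinearGroup (Fin 2) ℤ ≃*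
        Monoid.Coprod (CyclicGroup 2) (CyclicGroup 3)) ∧
      AdmitsFaithfulHighlyTransitiveAction (Matrix.ProjectiveSpecialLinearGroup (Fin 2) ℤ)) ∧
    (AdmitsHighlyTransitiveAction (Matrix.SpecialLinearGroup (Fin 2) ℤ) ∧
      ¬ AdmitsFaithfulHighlyTransitiveAction (Matrix.SpecialLinearGroup (Fin 2) ℤ)) := by
  have hPSL : AdmitsFaithfulHighlyTransitiveAction
      (Matrix.ProjectiveSpecialLinearGroup (Fin 2) ℤ) := by
    refine AdmitsFaithfulHighlyTransitiveAction.of_mulEquiv ?_ modularEquiv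
    refine admitsFaithfulHighlyTransitiveAction_coprod _ _ ?_
    rintro ⟨e⟩
    have h := Nat.card_congr e.toEquiv
    simp [Nat.card_eq_fintype_card] at h
  refine ⟨fun G H => admitsFaithfulHighlyTransitiveAction_coprod_iff G H,
    ⟨⟨modularEquiv⟩, hPSL⟩, ?_, ?_⟩
  · exact hPSL.admits.of_surjective _ (QuotientGroup.mk'_surjective _)
  · exact not_admitsFaithfulHighlyTransitiveAction_of_mem_center
      neg_one_mem_center_and_ne_one.1 neg_one_mem_center_and_ne_one.2
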